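/- Let $n\ge 1$ and let $X>0$ be a random variable (the service time), with $\mathbb E[X]\in(0,\infty]$. In the $(n,1)$ *fork-early-cancel system*, which starts empty at time $0$, each arriving job is forked into $n$ tasks that join first-come first-served queues, one at each of $n$ servers. As soon as one task of a job reaches the head of its queue and starts service, the other $n-1$ tasks of that job are cancelled and leave their queues immediately; if several tasks of the job would start service simultaneously, one of them, chosen uniformly at random, is retained. The service times are i.i.d. copies of $X$ across jobs and servers, the random choices are independent from job to job, and the arrivals, the service times and the choices are independent of one another. For $j=0,1,2,\dots$ the latency $T_j$ of job $j$ is the time from its arrival until its retained task has been served, and its computing cost $C_j$ is the total time that servers spend serving tasks of job $j$. The *long-run mean* of nonnegative quantities $Y_j$ attached to the jobs is $\limsup_{N\to\infty}\frac1N\sum_{j<N}\mathbb E[Y_j]\in[0,\infty]$, and their *steady-state law*, if it exists, is the weak limit of the law of $Y_j$ as $j\to\infty$. (a) For every arrival process, $\mathbb E[C_j]=\mathbb E[X]$ for every job $j$; in particular the long-run mean cost per job is $\mathbb E[X]$. (b) Suppose that the jobs arrive according to a Poisson process of rate $\lambda>0$, and consider an $M/G/n$ queue (Poisson arrivals of rate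 $\lambda$, independent i.i.d. service times distributed as $X$, $n$ servers, one central first-come first-served line, initially empty) with response times $T_j^{M/G/n}$. Then the two systems are equivalent: the sequence of the arrival, service-start and departure times of all jobs has the same joint law in both. Consequently $\mathbb E[T_j]=\mathbb E[T_j^{M/G/n}]$ for every $j$, the long-run mean latencies coincide, and a probability law $\nu$ on $\mathbb R$ is the steady-state law of $T_j$ if and only if it is the steady-state law of $T_j^{M/G/n}$. That is, $\mathbb E[T]=\mathbb E[T^{M/G/n}]$. -/

import Mathlib

open MeasureTheory ProbabilityTheory Filter Topology
open scoped ENNReal BoundedContinuousFunction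

noncomputable section

/-! ### The `(n,1)` fork-early-cancel system, along one sample path

Job `j` arrives at time `A j` and puts one task in the first-come first-served queue of each of the
`n` servers; `X j i` is the time server `i` needs for the task of job `j`. The system starts empty
at time `0`. As soon as one task of a job starts service, the other tasks of that job leave their
queues; if several tasks of the job would start simultaneously, on the servers in the set `s`, then
only the one on server `pick j s` is kept. -/
namespace ForkEarlyCancel

variable {n : ℕ} [NeZero n]

/-- A task that arrives at time `a` at server `i`, whose earlier tasks have all left by time `c i`,
is at the head of its queue, with the server available, from this time on. -/
def headTime (a : ℝ) (c : Fin n → ℝ) (i : Fin n) : ℝ := max a (c i)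

/-- The first time at which some task of the job can start service. -/
def firstHead (a : ℝ) (c : Fin n → ℝ) : ℝ :=
  Finset.univ.inf' Finset.univ_nonempty (headTime a c)

/-- The servers on which a task of the job can start service at that first time. -/
def tied (a : ℝ) (c : Fin n → ℝ) : Finset (Fin n) :=
  Finset.univ.filter fun i => headTime a c i = firstHead a c

/-- When the task on server `i` leaves: after its service on the retained server `w`, and at the
instant of cancellation on any other server. -/
def leaveTime (a : ℝ) (c x : Fin n → ℝ) (w i : Fin n) : ℝ :=
  if i = w then firstHead a c + x i else firstHead a c

/-- `clearTime A X pick j i`: the time by which all tasks of the jobs `0, …, j - 1` have left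
server `i`. -/
def clearTime (A : ℕ → ℝ) (X : ℕ → Fin n → ℝ) (pick : ℕ → Finset (Fin n) → Fin n) :
    ℕ → Fin n → ℝ
  | 0, _ => 0
  | j + 1, i =>
    max (clearTime A X pick j i)
      (leaveTime (A j) (clearTime A X pick j) (X j)
        (pick j (tied (A j) (clearTime A X pick j))) i)

/-- The server on which the task of job `j` is retained. -/
def winner (A : ℕ → ℝ) (X : ℕ → Fin n → ℝ) (pick : ℕ → Finset (Fin n) → Fin n) (j : ℕ) : Fin n :=
  pick j (tied (A j) (clearTime A X pick j))

/-- The time at which job `j` starts service. -/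
def start (A : ℕ → ℝ) (X : ℕ → Fin n → ℝ) (pick : ℕ → Finset (Fin n) → Fin n) (j : ℕ) : ℝ :=
  firstHead (A j) (clearTime A X pick j)

/-- The time at which job `j` is complete, that is, its retained task has been served. -/
def departure (A : ℕ → ℝ) (X : ℕ → Fin n → ℝ) (pick : ℕ → Finset (Fin n) → Fin n) (j : ℕ) : ℝ :=
  leaveTime (A j) (clearTime A X pick j) (X j) (winner A X pick j) (winner A X pick j)

/-- The latency of job `j`: the time from its arrival until it is served. -/
def latency (A : ℕ → ℝ) (X : ℕ → Fin n → ℝ) (pick : ℕ → Finset (Fin n) → Fin n) (j : ℕ) : ℝ :=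
  departure A X pick j - A j

/-- The computing cost of job `j`: the total time spent by the servers serving it. The server of a
task spends on it the time from the start of its service until the task leaves; for a task
cancelled on reaching the head of its queue, or before, this is no time at all. -/
def cost (A : ℕ → ℝ) (X : ℕ → Fin n → ℝ) (pick : ℕ → Finset (Fin n) → Fin n) (j : ℕ) : ℝ :=
  ∑ i : Fin n,
    (leaveTime (A j) (clearTime A X pick j) (X j) (winner A X pick j) i - start A X pick j)

end ForkEarlyCancel

/-! ### The `n`-server queue with one central first-come first-served line, along one sample path

Job `j` arrives at time `A j` and has service time `S j`. The system starts empty. -/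
namespace MultiServerQueue

/-- Job `j` starts service at the first time `t`, not before its own arrival and not before the
start of any earlier job, at which fewer than `n` of the earlier jobs are still in service. -/
def start (n : ℕ) (A S : ℕ → ℝ) (j : ℕ) : ℝ :=
  sInf {t : ℝ | A j ≤ t ∧ (∀ l : Fin j, start n A S l ≤ t) ∧
    (Finset.univ.filter fun l : Fin j => t < start n A S l + S l).card < n}
termination_by j
decreasing_by all_goals exact Fin.is_lt _

/-- The time at which job `j` has been served. -/
def departure (n : ℕ) (A S : ℕ → ℝ) (j : ℕ) : ℝ := start n A S j + S j

/-- The response time of job `j`. -/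
def responseTime (n : ℕ) (A S : ℕ → ℝ) (j : ℕ) : ℝ := departure n A S j - A j

end MultiServerQueue

/-! ### Stochastic assumptions -/

/-- The times between consecutive arrivals, the first one counted from time `0`. -/
def interarrival {Ω : Type*} (A : ℕ → Ω → ℝ) : ℕ → Ω → ℝ
  | 0 => A 0
  | j + 1 => fun ω => A (j + 1) ω - A j ω

/-- `A j`, `j = 0, 1, …`, are the successive points of a Poisson process of rate `lam` on `[0, ∞)`:
the interarrival times are i.i.d. exponential of parameter `lam`. -/
structure IsPoissonArrivals {Ω : Type*} [MeasurableSpace Ω] (P : Measure Ω) (lam : ℝ)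
    (A : ℕ → Ω → ℝ) : Prop where
  measurable : ∀ j, Measurable (A j)
  indep : iIndepFun (interarrival A) P
  law : ∀ j, P.map (interarrival A j) = expMeasure lam

/-- The random data of a fork-early-cancel system with service time law `μ`: an arbitrary arrival
process `A`, service times `X` that are i.i.d. of law `μ` across jobs and servers, and choices
`pick` that are uniform on each nonempty set of tied servers and independent from job to job; the
arrivals, the service times and the choices are independent of one another. -/
structure IsForkEarlyCancelInput {Ω : Type*} [MeasurableSpace Ω] (P : Measure Ω) {n : ℕ}
    (μ : Measure ℝ) (A : ℕ → Ω → ℝ) (X : ℕ → Fin n → Ω → ℝ)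
    (pick : ℕ → Ω → Finset (Fin n) → Fin n) : Prop where
  measurable_arrival : ∀ j, Measurable (A j)
  arrival_nonneg : ∀ᵐ ω ∂P, 0 ≤ A 0 ω
  arrival_mono : ∀ᵐ ω ∂P, Monotone fun j => A j ω
  measurable_service : ∀ j i, Measurable (X j i)
  law_service : ∀ j i, P.map (X j i) = μ
  indep_service : iIndepFun (fun (p : ℕ × Fin n) ω => X p.1 p.2 ω) P
  measurable_pick : ∀ j, Measurable (pick j)
  law_pick : ∀ j (s : Finset (Fin n)), s.Nonempty →
    P.map (fun ω => pick j ω s) = uniformOn (s : Set (Fin n))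
  indep_pick : iIndepFun pick P
  indep_service_pick : IndepFun (fun ω j i => X j i ω) (fun ω j => pick j ω) P
  indep_arrival : IndepFun (fun ω j => A j ω)
    (fun ω => ((fun j i => X j i ω : ℕ → Fin n → ℝ),
      (fun j => pick j ω : ℕ → Finset (Fin n) → Fin n))) P

/-- The random data of an `M/G/n` queue with arrival rate `lam` and service time law `μ`: Poisson
arrivals and, independently of them, i.i.d. service times of law `μ`. -/
structure IsMGInput {Ω : Type*} [MeasurableSpace Ω] (P : Measure Ω) (lam : ℝ) (μ : Measure ℝ)
    (A S : ℕ → Ω → ℝ) : Prop where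
  poisson : IsPoissonArrivals P lam A
  measurable_service : ∀ j, Measurable (S j)
  law_service : ∀ j, P.map (S j) = μ
  indep_service : iIndepFun S P
  indep_arrival : IndepFun (fun ω j => A j ω) (fun ω j => S j ω) P

/-! ### Means and steady state -/

/-- The expectation, in `[0, ∞]`, of a random variable that is almost surely nonnegative. -/
def mean {Ω : Type*} [MeasurableSpace Ω] (P : Measure Ω) (Y : Ω → ℝ) : ℝ≥0∞ :=
  ∫⁻ ω, ENNReal.ofReal (Y ω) ∂P

/-- The long-run mean per job of the quantity `Y j` attached to the jobs `j = 0, 1, …`: the limit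
(in general the upper limit) of the mean over the first `N` jobs. -/
def longRunMean {Ω : Type*} [MeasurableSpace Ω] (P : Measure Ω) (Y : ℕ → Ω → ℝ) : ℝ≥0∞ :=
  limsup (fun N : ℕ => (∑ j ∈ Finset.range N, mean P (Y j)) / (N : ℝ≥0∞)) atTop

/-- `ν` is the steady-state law of `Y j`: the weak limit of the law of `Y j` as `j → ∞`. -/
def IsSteadyStateLaw {Ω : Type*} [MeasurableSpace Ω] (P : Measure Ω) (Y : ℕ → Ω → ℝ)
    (ν : Measure ℝ) : Prop :=
  IsProbabilityMeasure ν ∧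
    ∀ f : ℝ →ᵇ ℝ, Tendsto (fun j => ∫ ω, f (Y j ω) ∂P) atTop (𝓝 (∫ x, f x ∂ν))

/-! ### The latency and cost of the random systems -/

/-- The latency of job `j` in the random fork-early-cancel system. -/
def forkLatency {Ω : Type*} {n : ℕ} [NeZero n] (A : ℕ → Ω → ℝ) (X : ℕ → Fin n → Ω → ℝ)
    (pick : ℕ → Ω → Finset (Fin n) → Fin n) (j : ℕ) (ω : Ω) : ℝ :=
  ForkEarlyCancel.latency (fun j => A j ω) (fun j i => X j i ω) (fun j => pick j ω) j

/-- The computing cost of job `j` in the random fork-early-cancel system. -/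
def forkCost {Ω : Type*} {n : ℕ} [NeZero n] (A : ℕ → Ω → ℝ) (X : ℕ → Fin n → Ω → ℝ)
    (pick : ℕ → Ω → Finset (Fin n) → Fin n) (j : ℕ) (ω : Ω) : ℝ :=
  ForkEarlyCancel.cost (fun j => A j ω) (fun j i => X j i ω) (fun j => pick j ω) j

/-- Arrival, start and departure times of all jobs in the random fork-early-cancel system. -/
def forkHistory {Ω : Type*} {n : ℕ} [NeZero n] (A : ℕ → Ω → ℝ) (X : ℕ → Fin n → Ω → ℝ)
    (pick : ℕ → Ω → Finset (Fin n) → Fin n) (ω : Ω) : ℕ → ℝ × ℝ × ℝ := fun j =>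
  (A j ω,
    ForkEarlyCancel.start (fun j => A j ω) (fun j i => X j i ω) (fun j => pick j ω) j,
    ForkEarlyCancel.departure (fun j => A j ω) (fun j i => X j i ω) (fun j => pick j ω) j)

/-- The response time of job `j` in the random `n`-server queue. -/
def queueResponse {Ω : Type*} (n : ℕ) (A S : ℕ → Ω → ℝ) (j : ℕ) (ω : Ω) : ℝ :=
  MultiServerQueue.responseTime n (fun j => A j ω) (fun j => S j ω) j

/-- Arrival, start and departure times of all jobs in the random `n`-server queue. -/
def queueHistory {Ω : Type*} (n : ℕ) (A S : ℕ → Ω → ℝ) (ω : Ω) : ℕ → ℝ × ℝ × ℝ := fun j =>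
  (A j ω,
    MultiServerQueue.start n (fun j => A j ω) (fun j => S j ω) j,
    MultiServerQueue.departure n (fun j => A j ω) (fun j => S j ω) j)

end

/-! The server that serves job `j` is determined by the arrivals, the tie-breaking choices and the
service times of the jobs before `j`, all of which are independent of the service times of job `j`.
So the service times that are actually spent are i.i.d. copies of `X`, independent of the arrivals,
and each is the whole cost of its job. Along each path, as long as the jobs `0, …, j - 1` have all
started by time `t`, those still in service at time `t` occupy distinct servers, namely the ones not
yet clear at time `t`. Hence job `j` starts as soon as it has arrived, all earlier jobs have started
and fewer than `n` of them are still in service, which is the rule of the central-line queue fed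
with the same arrivals and the service times actually spent. -/

section Independence

variable {Ω : Type*} {mΩ : MeasurableSpace Ω} {P : Measure Ω}

theorem iIndep_of_indep_iSup_lt {ι : Type*} [LinearOrder ι] [IsProbabilityMeasure P]
    {m : ι → MeasurableSpace Ω} (h : ∀ i, Indep (⨆ k < i, m k) (m i) P) : iIndep m P := by
  refine (iIndep_iff m P).2 fun s => ?_
  induction s using Finset.induction_on_max with
  | empty => simp
  | insert i s hlt ih =>
    intro f hf
    have hpast : MeasurableSet[⨆ k < i, m k] (⋂ k ∈ s, f k) :=
      Finset.measurableSet_biInter s fun k hk =>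
        le_iSup₂ (f := fun k (_ : k < i) => m k) k (hlt k hk) _
          (hf k (Finset.mem_insert_of_mem hk))
    rw [Finset.set_biInter_insert, Finset.prod_insert fun hi => (hlt i hi).false, Set.inter_comm,
      (Indep_iff _ _ _).1 (h i) _ _ hpast (hf i (Finset.mem_insert_self i s)),
      ih fun k hk => hf k (Finset.mem_insert_of_mem hk), mul_comm]

theorem indep_sup_left_of_indep_sup_right [IsProbabilityMeasure P]
    {m₁ m₂ m₃ : MeasurableSpace Ω} (hm₁ : m₁ ≤ mΩ) (hm₂ : m₂ ≤ mΩ) (hm₃ : m₃ ≤ mΩ)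
    (h₁ : Indep m₁ (m₂ ⊔ m₃) P) (h₂ : Indep m₂ m₃ P) : Indep (m₁ ⊔ m₂) m₃ P := by
  have hindep : iIndep ![m₂, m₃, m₁] P := by
    refine iIndep_of_indep_iSup_lt fun i => ?_
    fin_cases i
    · simpa using indep_bot_left m₂
    · simpa [Fin.lt_def, iSup_fin_three] using h₂
    · simpa [Fin.lt_def] using h₁.symm
  have hle : ∀ i, ![m₂, m₃, m₁] i ≤ mΩ := by simp [Fin.forall_fin_succ, *]
  have h := indep_iSup_of_disjoint hle hindep (S := {2, 0}) (T := {1}) (by simp)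
  simpa [iSup_insert, sup_comm] using h

theorem indep_iSup_of_indep_sup_iSup_lt [IsProbabilityMeasure P] {m₀ : MeasurableSpace Ω}
    {m : ℕ → MeasurableSpace Ω} (hm₀ : m₀ ≤ mΩ) (hm : ∀ j, m j ≤ mΩ)
    (h : ∀ j, Indep (m₀ ⊔ ⨆ l < j, m l) (m j) P) : Indep m₀ (⨆ j, m j) P := by
  have hpast_le : ∀ j, ⨆ l < j, m l ≤ mΩ := fun j => iSup₂_le fun l _ => hm l
  have hpast : ∀ j, Indep (⨆ l < j, m l) m₀ P := by
    intro j
    induction j with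
    | zero => simpa using indep_bot_left m₀
    | succ j ih =>
      rw [Nat.iSup_lt_succ, sup_comm]
      refine indep_sup_left_of_indep_sup_right (hm j) (hpast_le j) hm₀ ?_ ih
      rw [sup_comm]
      exact (h j).symm
  have hmono : Monotone fun j => ⨆ l < j, m l := fun j k hjk =>
    biSup_mono fun l hl => hl.trans_le hjk
  have hiSup : ⨆ j, m j ≤ ⨆ j, ⨆ l < j, m l := iSup_le fun j =>
    le_iSup_of_le (j + 1) (le_iSup₂ (f := fun l (_ : l < j + 1) => m l) j j.lt_succ_self)
  exact indep_of_indep_of_le_right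
    (indep_iSup_of_monotone hpast hpast_le hm₀ hmono).symm hiSup

end Independence

section Selection

variable {Ω ι E : Type*} [MeasurableSpace ι] [Countable ι] [MeasurableSingletonClass ι]
  [MeasurableSpace E] {w : Ω → ι}

theorem measurable_select [MeasurableSpace Ω] {X : ι → Ω → E}
    (hX : ∀ i, Measurable (X i)) (hw : Measurable w) : Measurable fun ω => X (w ω) ω :=
  (measurable_from_prod_countable_right (f := fun p : ι × Ω => X p.1 p.2) hX).comp
    (hw.prodMk measurable_id)

variable {m mΩ : MeasurableSpace Ω} {P : Measure Ω} {μ : Measure E} {X : ι → Ω → E}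

theorem measure_inter_preimage_select (hm : m ≤ mΩ) (hw : Measurable[m] w)
    (hX : ∀ i, Measurable (X i)) (hμ : ∀ i, P.map (X i) = μ)
    (hind : ∀ i, Indep m (MeasurableSpace.comap (X i) inferInstance) P)
    {B : Set Ω} (hB : MeasurableSet[m] B) {t : Set E} (ht : MeasurableSet t) :
    P (B ∩ (fun ω => X (w ω) ω) ⁻¹' t) = P B * μ t := by
  have hBw (i : ι) : MeasurableSet[m] (B ∩ w ⁻¹' {i}) := hB.inter (hw (measurableSet_singleton i))
  have hdisj : Pairwise (Function.onFun Disjoint fun i => B ∩ w ⁻¹' {i}) := fun i k hik =>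
    ((Set.disjoint_singleton.2 hik).preimage w).mono Set.inter_subset_right Set.inter_subset_right
  have hpiece (i : ι) : P (B ∩ w ⁻¹' {i} ∩ X i ⁻¹' t) = P (B ∩ w ⁻¹' {i}) * μ t := by
    rw [(Indep_iff _ _ _).1 (hind i) _ _ (hBw i) ⟨t, ht, rfl⟩, ← hμ i,
      Measure.map_apply (hX i) ht]
  calc P (B ∩ (fun ω => X (w ω) ω) ⁻¹' t)
      = P (⋃ i, B ∩ w ⁻¹' {i} ∩ X i ⁻¹' t) := by
        congr 1
        ext ω
        simp [and_assoc]
    _ = ∑' i, P (B ∩ w ⁻¹' {i} ∩ X i ⁻¹' t) :=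
        measure_iUnion (hdisj.mono fun _ _ h => h.mono Set.inter_subset_left Set.inter_subset_left)
          fun i => (hm _ (hBw i)).inter (hX i ht)
    _ = (∑' i, P (B ∩ w ⁻¹' {i})) * μ t := by simp_rw [hpiece, ENNReal.tsum_mul_right]
    _ = P (⋃ i, B ∩ w ⁻¹' {i}) * μ t := by
        rw [measure_iUnion hdisj fun i => hm _ (hBw i)]
    _ = P B * μ t := by
        rw [← Set.inter_iUnion, ← Set.preimage_iUnion, Set.iUnion_of_singleton, Set.preimage_univ,
          Set.inter_univ]

variable [IsProbabilityMeasure P]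

theorem map_select_of_indep (hm : m ≤ mΩ) (hw : Measurable[m] w)
    (hX : ∀ i, Measurable (X i)) (hμ : ∀ i, P.map (X i) = μ)
    (hind : ∀ i, Indep m (MeasurableSpace.comap (X i) inferInstance) P) :
    P.map (fun ω => X (w ω) ω) = μ := by
  ext t ht
  rw [Measure.map_apply (measurable_select hX (hw.mono hm le_rfl)) ht]
  simpa using measure_inter_preimage_select hm hw hX hμ hind MeasurableSet.univ ht

theorem indep_comap_select (hm : m ≤ mΩ) (hw : Measurable[m] w)
    (hX : ∀ i, Measurable (X i)) (hμ : ∀ i, P.map (X i) = μ)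
    (hind : ∀ i, Indep m (MeasurableSpace.comap (X i) inferInstance) P) :
    Indep m (MeasurableSpace.comap (fun ω => X (w ω) ω) inferInstance) P := by
  rw [Indep_iff]
  rintro B _ hB ⟨t, ht, rfl⟩
  rw [measure_inter_preimage_select hm hw hX hμ hind hB ht,
    ← map_select_of_indep hm hw hX hμ hind,
    Measure.map_apply (measurable_select hX (hw.mono hm le_rfl)) ht]

end Selection

section PredictableSelection

variable {Ω ι E : Type*} [MeasurableSpace ι] [Countable ι] [MeasurableSingletonClass ι]
  [MeasurableSpace E] {mΩ : MeasurableSpace Ω} {P : Measure Ω} [IsProbabilityMeasure P]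
  {μ : Measure E} {ℱ : Filtration ℕ mΩ} {X : ℕ → ι → Ω → E} {w : ℕ → Ω → ι}

theorem comap_select_le_filtration (hX : ∀ j i, Measurable[ℱ (j + 1)] (X j i))
    (hw : ∀ j, Measurable[ℱ j] (w j)) {l j : ℕ} (h : l < j) :
    MeasurableSpace.comap (fun ω => X l (w l ω) ω) inferInstance ≤ ℱ j :=
  Measurable.comap_le <| @measurable_select _ _ _ _ _ _ _ _ (ℱ j) _
    (fun i => (hX l i).mono (ℱ.mono h) le_rfl) ((hw l).mono (ℱ.mono h.le) le_rfl)

theorem iIndepFun_predictable_select (hX : ∀ j i, Measurable[ℱ (j + 1)] (X j i))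
    (hμ : ∀ j i, P.map (X j i) = μ)
    (hindep : ∀ j i, Indep (ℱ j) (MeasurableSpace.comap (X j i) inferInstance) P)
    (hw : ∀ j, Measurable[ℱ j] (w j)) : iIndepFun (fun j ω => X j (w j ω) ω) P :=
  iIndep_of_indep_iSup_lt fun j => indep_of_indep_of_le_left
    (indep_comap_select (ℱ.le j) (hw j) (fun i => (hX j i).mono (ℱ.le _) le_rfl) (hμ j) (hindep j))
    (iSup₂_le fun _ hl => comap_select_le_filtration hX hw hl)

theorem indep_comap_predictable_select (hX : ∀ j i, Measurable[ℱ (j + 1)] (X j i))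
    (hμ : ∀ j i, P.map (X j i) = μ)
    (hindep : ∀ j i, Indep (ℱ j) (MeasurableSpace.comap (X j i) inferInstance) P)
    (hw : ∀ j, Measurable[ℱ j] (w j)) :
    Indep (ℱ 0) (MeasurableSpace.comap (fun ω j => X j (w j ω) ω) inferInstance) P := by
  have hselect_le (j : ℕ) : MeasurableSpace.comap (fun ω => X j (w j ω) ω) inferInstance ≤ mΩ :=
    (comap_select_le_filtration hX hw j.lt_succ_self).trans (ℱ.le _)
  have h := indep_iSup_of_indep_sup_iSup_lt (ℱ.le 0) hselect_le fun j => indep_of_indep_of_le_left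
    (indep_comap_select (ℱ.le j) (hw j) (fun i => (hX j i).mono (ℱ.le _) le_rfl) (hμ j) (hindep j))
    (sup_le (ℱ.mono j.zero_le) (iSup₂_le fun l hl => comap_select_le_filtration hX hw hl))
  simpa only [MeasurableSpace.pi, MeasurableSpace.comap_iSup, MeasurableSpace.comap_comp,
    Function.comp_def] using h

end PredictableSelection

section RowFiltration

variable {Ω ι E β : Type*} [MeasurableSpace E] [MeasurableSpace β] {mΩ : MeasurableSpace Ω}
  {P : Measure Ω} {Z : Ω → β} {X : ℕ → ι → Ω → E}

/-- The filtration whose `j`-th σ-algebra is generated by `Z` and the rows `0, …, j - 1` of the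
array `X`. -/
def rowFiltration (hZ : Measurable Z) (hX : ∀ j i, Measurable (X j i)) : Filtration ℕ mΩ where
  seq j := MeasurableSpace.comap Z inferInstance ⊔
    ⨆ p ∈ {p : ℕ × ι | p.1 < j}, MeasurableSpace.comap (X p.1 p.2) inferInstance
  mono' _ _ hjk := sup_le_sup_left (biSup_mono fun _ hp => lt_of_lt_of_le hp hjk) _
  le' _ := sup_le hZ.comap_le (iSup₂_le fun p _ => (hX p.1 p.2).comap_le)

variable (hZ : Measurable Z) (hX : ∀ j i, Measurable (X j i))

theorem measurable_rowFiltration_left (j : ℕ) : Measurable[rowFiltration hZ hX j] Z :=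
  Measurable.of_comap_le le_sup_left

theorem measurable_rowFiltration_row {l j : ℕ} (h : l < j) (i : ι) :
    Measurable[rowFiltration hZ hX j] (X l i) :=
  Measurable.of_comap_le <| le_sup_of_le_right <|
    le_iSup₂ (f := fun (p : ℕ × ι) (_ : p ∈ {p : ℕ × ι | p.1 < j}) =>
      MeasurableSpace.comap (X p.1 p.2) inferInstance) (l, i) h

theorem indep_rowFiltration_row (hindep : iIndepFun (fun (p : ℕ × ι) ω => X p.1 p.2 ω) P)
    (hZX : IndepFun Z (fun ω j i => X j i ω) P) (j : ℕ) (i : ι) :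
    Indep (rowFiltration hZ hX j) (MeasurableSpace.comap (X j i) inferInstance) P := by
  have := hindep.isProbabilityMeasure
  have hrow_le (p : ℕ × ι) : MeasurableSpace.comap (X p.1 p.2) inferInstance ≤
      MeasurableSpace.comap (fun ω j i => X j i ω) inferInstance := by
    have heval : Measurable fun x : ℕ → ι → E => x p.1 p.2 := by fun_prop
    rintro _ ⟨t, ht, rfl⟩
    exact ⟨_, heval ht, rfl⟩
  refine indep_sup_left_of_indep_sup_right hZ.comap_le
    (iSup₂_le fun p _ => (hX p.1 p.2).comap_le) (hX j i).comap_le ?_ ?_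
  · exact indep_of_indep_of_le_right hZX
      (sup_le (iSup₂_le fun p _ => hrow_le p) (hrow_le (j, i)))
  · simpa using indep_iSup_of_disjoint (fun p : ℕ × ι => (hX p.1 p.2).comap_le) hindep
      (S := {p | p.1 < j}) (T := {(j, i)}) (by simp)

end RowFiltration

theorem isClosed_setOf_card_filter_lt {α ι : Type*} [TopologicalSpace α] [LinearOrder α]
    [ClosedIciTopology α] [Fintype ι] (d : ι → α) (n : ℕ) :
    IsClosed {t | (Finset.univ.filter fun i => t < d i).card < n} := by
  have h : {t | (Finset.univ.filter fun i => t < d i).card < n} =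
      ⋃ s ∈ {s : Finset ι | s.card < n}, ⋂ i ∈ (s : Set ι)ᶜ, Set.Ici (d i) := by
    ext t
    simp only [Set.mem_ofPred_eq, Set.mem_iUnion, Set.mem_iInter, Set.mem_compl_iff,
      Finset.mem_coe, Set.mem_Ici, exists_prop]
    refine ⟨fun ht => ⟨_, ht, by simp⟩, fun ⟨s, hs, hst⟩ => ?_⟩
    refine (Finset.card_le_card fun i hi => ?_).trans_lt hs
    by_contra his
    exact (hst i his).not_gt (Finset.mem_filter.1 hi).2
  rw [h]
  exact (Set.toFinite _).isClosed_biUnion fun s _ => isClosed_biInter fun i _ => isClosed_Ici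

namespace MultiServerQueue

variable {n : ℕ} [NeZero n]

theorem start_le_iff {A S : ℕ → ℝ} {j : ℕ} {t : ℝ} :
    start n A S j ≤ t ↔ A j ≤ t ∧ (∀ l < j, start n A S l ≤ t) ∧
      ((Finset.range j).filter fun l => t < departure n A S l).card < n := by
  set I : Set ℝ := {t | A j ≤ t ∧ (∀ l : Fin j, start n A S l ≤ t) ∧
    (Finset.univ.filter fun l : Fin j => t < departure n A S l).card < n} with hI
  have hstart : start n A S j = sInf I := by
    rw [start]
    rfl
  have hclosed : IsClosed I := by
    simp only [hI, Set.ofPred_and, Set.ofPred_forall]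
    exact isClosed_Ici.inter ((isClosed_iInter fun l => isClosed_Ici).inter
      (isClosed_setOf_card_filter_lt _ n))
  have hbdd : BddBelow I := ⟨A j, fun t ht => ht.1⟩
  have hne : I.Nonempty := by
    have hev : ∀ᶠ t in atTop, A j ≤ t ∧ (∀ l : Fin j, start n A S l ≤ t) ∧
        ∀ l : Fin j, departure n A S l ≤ t :=
      (eventually_ge_atTop _).and <| (eventually_all.2 fun l => eventually_ge_atTop _).and
        (eventually_all.2 fun l => eventually_ge_atTop _)
    obtain ⟨t, hAt, hstart_le, hdep_le⟩ := hev.exists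
    have hidle : (Finset.univ.filter fun l : Fin j => t < departure n A S l).card < n := by
      rw [Finset.filter_false_of_mem fun l _ => (hdep_le l).not_gt]
      exact Nat.pos_of_neZero n
    exact ⟨t, hAt, hstart_le, hidle⟩
  have hupper : IsUpperSet I := fun s t hst hs =>
    ⟨hs.1.trans hst, fun l => (hs.2.1 l).trans hst, hs.2.2.trans_le' <| Finset.card_le_card <|
      Finset.monotone_filter_right _ fun l _ hl => hst.trans_lt hl⟩
  have hmem : start n A S j ≤ t ↔ t ∈ I := by
    rw [hstart]
    exact ⟨fun h => hupper h (hclosed.csInf_mem hne hbdd), csInf_le hbdd⟩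
  simp only [hmem, hI, Set.mem_ofPred_eq, Fin.forall_iff, Finset.card_filter, Finset.sum_range]

theorem measurable_start {Ω : Type*} [MeasurableSpace Ω] {A S : ℕ → Ω → ℝ}
    (hA : ∀ j, Measurable (A j)) (hS : ∀ j, Measurable (S j)) (j : ℕ) :
    Measurable fun ω => start n (fun j => A j ω) (fun j => S j ω) j := by
  induction j using Nat.strong_induction_on with
  | _ j ih =>
    refine measurable_of_Iic fun t => ?_
    have hcard : Measurable fun ω => ((Finset.range j).filter fun l =>
        t < departure n (fun j => A j ω) (fun j => S j ω) l).card := by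
      simp only [Finset.card_filter]
      exact Finset.measurable_fun_sum _ fun l hl => Measurable.ite
        (measurableSet_lt measurable_const ((ih l (Finset.mem_range.1 hl)).add (hS l)))
        measurable_const measurable_const
    have hset : (fun ω => start n (fun j => A j ω) (fun j => S j ω) j) ⁻¹' Set.Iic t =
        {ω | A j ω ≤ t ∧ (∀ l < j, start n (fun j => A j ω) (fun j => S j ω) l ≤ t) ∧
          ((Finset.range j).filter fun l =>
            t < departure n (fun j => A j ω) (fun j => S j ω) l).card < n} :=
      Set.ext fun ω => start_le_iff
    simp only [hset, Set.ofPred_and, Set.ofPred_forall]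
    exact (measurableSet_le (hA j) measurable_const).inter <|
      (MeasurableSet.iInter fun l => MeasurableSet.iInter fun hl =>
        measurableSet_le (ih l hl) measurable_const).inter (measurableSet_lt hcard measurable_const)

end MultiServerQueue

theorem measurable_queueHistory {Ω : Type*} [MeasurableSpace Ω] {n : ℕ} [NeZero n]
    {A S : ℕ → Ω → ℝ} (hA : ∀ j, Measurable (A j)) (hS : ∀ j, Measurable (S j)) :
    Measurable (queueHistory n A S) :=
  measurable_pi_iff.2 fun j =>
    have hstart := MultiServerQueue.measurable_start hA hS j
    (hA j).prodMk (hstart.prodMk (hstart.add (hS j)))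

namespace ForkEarlyCancel

variable {n : ℕ} [NeZero n]

theorem firstHead_le_iff {a t : ℝ} {c : Fin n → ℝ} :
    firstHead a c ≤ t ↔ a ≤ t ∧ ∃ i, c i ≤ t := by
  simp [firstHead, headTime, Finset.inf'_le_iff]

theorem tied_nonempty (a : ℝ) (c : Fin n → ℝ) : (tied a c).Nonempty := by
  obtain ⟨i, -, hi⟩ := Finset.exists_mem_eq_inf' Finset.univ_nonempty (headTime a c)
  exact ⟨i, by simp [tied, firstHead, hi]⟩

section Path

variable (A : ℕ → ℝ) (X : ℕ → Fin n → ℝ) (pick : ℕ → Finset (Fin n) → Fin n)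

/-- The service time of job `j` on the server where its task is retained. -/
noncomputable def retainedService (j : ℕ) : ℝ := X j (winner A X pick j)

theorem departure_eq_start_add (j : ℕ) :
    departure A X pick j = start A X pick j + retainedService A X pick j := by
  simp [departure, leaveTime, start, retainedService]

theorem cost_eq_retainedService (j : ℕ) : cost A X pick j = retainedService A X pick j := by
  rw [cost, Finset.sum_eq_single_of_mem (winner A X pick j) (Finset.mem_univ _)]
  · simp [leaveTime, start, retainedService]
  · intro i _ hi
    simp [leaveTime, hi, start]

theorem clearTime_succ (j : ℕ) (i : Fin n) :
    clearTime A X pick (j + 1) i = max (clearTime A X pick j i)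
      (if i = winner A X pick j then departure A X pick j else start A X pick j) := by
  change max _ (leaveTime _ _ _ (winner A X pick j) i) = _
  by_cases hi : i = winner A X pick j
  · simp [hi, departure]
  · simp [hi, leaveTime, start]

variable {A X pick}

theorem start_monotone (hS : ∀ j, 0 ≤ retainedService A X pick j) :
    Monotone (start A X pick) := by
  refine monotone_nat_of_le_succ fun j => ?_
  refine Finset.le_inf' Finset.univ_nonempty _ fun i _ => le_max_of_le_right ?_
  rw [clearTime_succ]
  refine le_max_of_le_right ?_
  split_ifs
  · exact departure_eq_start_add A X pick j ▸ le_add_of_nonneg_right (hS j)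
  · exact le_rfl

theorem lt_clearTime_succ_iff {t : ℝ} {j : ℕ} (ht : start A X pick j ≤ t) (i : Fin n) :
    t < clearTime A X pick (j + 1) i ↔
      t < clearTime A X pick j i ∨ i = winner A X pick j ∧ t < departure A X pick j := by
  rw [clearTime_succ, lt_max_iff]
  split_ifs with hi
  · simp [hi]
  · simp [hi, ht.not_gt]

theorem clearTime_winner_le_start (hpick : ∀ j s, s.Nonempty → pick j s ∈ s) (j : ℕ) :
    clearTime A X pick j (winner A X pick j) ≤ start A X pick j := by
  have htied : winner A X pick j ∈ tied (A j) (clearTime A X pick j) :=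
    hpick j _ (tied_nonempty _ _)
  exact (le_max_right _ _).trans_eq (Finset.mem_filter.1 htied).2

theorem card_filter_lt_departure (hpick : ∀ j s, s.Nonempty → pick j s ∈ s) {t : ℝ}
    (ht : 0 ≤ t) (j : ℕ) (hstart : ∀ l < j, start A X pick l ≤ t) :
    ((Finset.range j).filter fun l => t < departure A X pick l).card =
      (Finset.univ.filter fun i => t < clearTime A X pick j i).card := by
  induction j with
  | zero => simp [clearTime, ht.not_gt]
  | succ j ih =>
    have hj := hstart j j.lt_succ_self
    have hidle : winner A X pick j ∉ Finset.univ.filter fun i => t < clearTime A X pick j i := by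
      simpa using (clearTime_winner_le_start hpick j).trans hj
    rw [Finset.range_add_one, Finset.filter_insert]
    simp only [lt_clearTime_succ_iff hj]
    split_ifs with hd
    · rw [Finset.card_insert_of_notMem (by simp), ih fun l hl => hstart l (hl.trans j.lt_succ_self),
        ← Finset.card_insert_of_notMem hidle]
      congr 1
      ext i
      simp [hd, or_comm]
    · simp [hd, ih fun l hl => hstart l (hl.trans j.lt_succ_self)]

theorem start_le_iff (hpick : ∀ j s, s.Nonempty → pick j s ∈ s)
    (hS : ∀ j, 0 ≤ retainedService A X pick j) {j : ℕ} (hA : 0 ≤ A j) {t : ℝ} :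
    start A X pick j ≤ t ↔ A j ≤ t ∧ (∀ l < j, start A X pick l ≤ t) ∧
      ((Finset.range j).filter fun l => t < departure A X pick l).card < n := by
  have hprev : start A X pick j ≤ t → ∀ l < j, start A X pick l ≤ t := fun h l hl =>
    (start_monotone hS hl.le).trans h
  have hcard (hAt : A j ≤ t) (hl : ∀ l < j, start A X pick l ≤ t) :
      ((Finset.range j).filter fun l => t < departure A X pick l).card < n ↔
        ∃ i, clearTime A X pick j i ≤ t := by
    rw [card_filter_lt_departure hpick (hA.trans hAt) j hl]
    simpa [Finset.filter_eq_self] using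
      Finset.card_lt_iff_ne_univ (Finset.univ.filter fun i => t < clearTime A X pick j i)
  have hfirst : start A X pick j ≤ t ↔ A j ≤ t ∧ ∃ i, clearTime A X pick j i ≤ t :=
    firstHead_le_iff
  constructor
  · intro h
    obtain ⟨hAt, hfree⟩ := hfirst.1 h
    exact ⟨hAt, hprev h, (hcard hAt (hprev h)).2 hfree⟩
  · rintro ⟨hAt, hl, hlt⟩
    exact hfirst.2 ⟨hAt, (hcard hAt hl).1 hlt⟩

theorem start_eq_queue_start (hA : ∀ j, 0 ≤ A j) (hS : ∀ j, 0 ≤ retainedService A X pick j)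
    (hpick : ∀ j s, s.Nonempty → pick j s ∈ s) (j : ℕ) :
    start A X pick j = MultiServerQueue.start n A (retainedService A X pick) j := by
  induction j using Nat.strong_induction_on with
  | _ j ih =>
    have hdep : ∀ l < j, departure A X pick l =
        MultiServerQueue.departure n A (retainedService A X pick) l := fun l hl => by
      rw [departure_eq_start_add, ih l hl, MultiServerQueue.departure]
    refine eq_of_forall_ge_iff fun t => ?_
    rw [start_le_iff hpick hS (hA j), MultiServerQueue.start_le_iff,
      Finset.filter_congr fun l hl => by rw [hdep l (Finset.mem_range.1 hl)]]
    simp +contextual only [ih]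

end Path

section Measurability

variable {Ω : Type*} [MeasurableSpace Ω] {a : Ω → ℝ} {c : Ω → Fin n → ℝ}

theorem measurable_firstHead (ha : Measurable a) (hc : Measurable c) :
    Measurable fun ω => firstHead (a ω) (c ω) := by
  refine measurable_of_Iic fun t => ?_
  simp only [Set.preimage, Set.mem_Iic, firstHead_le_iff, Set.ofPred_and, Set.ofPred_exists]
  exact (measurableSet_le ha measurable_const).inter
    (MeasurableSet.iUnion fun i => measurableSet_le hc.eval measurable_const)

theorem measurableSet_tied_eq (ha : Measurable a) (hc : Measurable c) (s : Finset (Fin n)) :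
    MeasurableSet {ω | tied (a ω) (c ω) = s} := by
  simp only [tied, Finset.ext_iff, Finset.mem_filter, Finset.mem_univ, true_and, Set.ofPred_forall]
  exact MeasurableSet.iInter fun i => MeasurableSet.iff
    (measurableSet_eq_fun (ha.max hc.eval) (measurable_firstHead ha hc)) (MeasurableSet.const _)

theorem measurable_pick_tied {p : Ω → Finset (Fin n) → Fin n} (ha : Measurable a)
    (hc : Measurable c) (hp : Measurable p) : Measurable fun ω => p ω (tied (a ω) (c ω)) := by
  let _ : MeasurableSpace (Finset (Fin n)) := ⊤
  exact measurable_select (X := fun s ω => p ω s) (measurable_pi_iff.1 hp)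
    (measurable_to_countable' (measurableSet_tied_eq ha hc))

variable {A : ℕ → Ω → ℝ} {X : ℕ → Fin n → Ω → ℝ} {pick : ℕ → Ω → Finset (Fin n) → Fin n}

theorem measurable_clearTime (hA : ∀ j, Measurable (A j)) (hpick : ∀ j, Measurable (pick j))
    {j : ℕ} (hX : ∀ l < j, ∀ i, Measurable (X l i)) :
    Measurable fun ω => clearTime (fun j => A j ω) (fun j i => X j i ω) (fun j => pick j ω) j := by
  induction j with
  | zero => exact measurable_const
  | succ j ih =>
    have hc := ih fun l hl => hX l (hl.trans j.lt_succ_self)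
    have hhead := measurable_firstHead (hA j) hc
    refine measurable_pi_iff.2 fun i => hc.eval.max <| Measurable.ite ?_
      (hhead.add (hX j j.lt_succ_self i)) hhead
    exact measurableSet_eq_fun measurable_const (measurable_pick_tied (hA j) hc (hpick j))

theorem measurable_winner (hA : ∀ j, Measurable (A j)) (hpick : ∀ j, Measurable (pick j))
    {j : ℕ} (hX : ∀ l < j, ∀ i, Measurable (X l i)) :
    Measurable fun ω => winner (fun j => A j ω) (fun j i => X j i ω) (fun j => pick j ω) j :=
  measurable_pick_tied (hA j) (measurable_clearTime hA hpick hX) (hpick j)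

end Measurability

end ForkEarlyCancel

section Inputs

variable {Ω : Type*} [MeasurableSpace Ω] {P : Measure Ω} {n : ℕ} {μ : Measure ℝ}
  {A : ℕ → Ω → ℝ} {X : ℕ → Fin n → Ω → ℝ} {pick : ℕ → Ω → Finset (Fin n) → Fin n}

/-- The random data of a `G/GI/n` queue: i.i.d. service times of law `μ`, independent of an
arbitrary arrival process. -/
structure IsQueueInput (P : Measure Ω) (μ : Measure ℝ) (A S : ℕ → Ω → ℝ) : Prop where
  measurable_arrival : ∀ j, Measurable (A j)
  measurable_service : ∀ j, Measurable (S j)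
  law_service : ∀ j, P.map (S j) = μ
  indep_service : iIndepFun S P
  indep_arrival : IndepFun (fun ω j => A j ω) (fun ω j => S j ω) P

/-- The random data of a fork-early-cancel system whose tie-breaking choices may have any joint law
and may depend on the arrivals, but not on the i.i.d. service times. -/
structure IsForkInput (P : Measure Ω) (μ : Measure ℝ) (A : ℕ → Ω → ℝ) (X : ℕ → Fin n → Ω → ℝ)
    (pick : ℕ → Ω → Finset (Fin n) → Fin n) : Prop where
  measurable_arrival : ∀ j, Measurable (A j)
  arrival_nonneg : ∀ᵐ ω ∂P, ∀ j, 0 ≤ A j ω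
  measurable_pick : ∀ j, Measurable (pick j)
  pick_mem : ∀ᵐ ω ∂P, ∀ j (s : Finset (Fin n)), s.Nonempty → pick j ω s ∈ s
  measurable_service : ∀ j i, Measurable (X j i)
  law_service : ∀ j i, P.map (X j i) = μ
  indep_service : iIndepFun (fun (p : ℕ × Fin n) ω => X p.1 p.2 ω) P
  indep_arrival_pick : IndepFun
    (fun ω => ((fun j => A j ω : ℕ → ℝ), (fun j => pick j ω : ℕ → Finset (Fin n) → Fin n)))
    (fun ω j i => X j i ω) P

theorem IsMGInput.isQueueInput {lam : ℝ} {S : ℕ → Ω → ℝ} (h : IsMGInput P lam μ A S) :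
    IsQueueInput P μ A S where
  measurable_arrival := h.poisson.measurable
  measurable_service := h.measurable_service
  law_service := h.law_service
  indep_service := h.indep_service
  indep_arrival := h.indep_arrival

namespace IsForkEarlyCancelInput

theorem ae_pick_mem (h : IsForkEarlyCancelInput P μ A X pick) :
    ∀ᵐ ω ∂P, ∀ j (s : Finset (Fin n)), s.Nonempty → pick j ω s ∈ s := by
  refine ae_all_iff.2 fun j => ae_all_iff.2 fun s => eventually_imp_distrib_left.2 fun hs => ?_
  have hmem : ∀ᵐ i ∂(P.map fun ω => pick j ω s), i ∈ s := by
    rw [h.law_pick j s hs]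
    exact ae_cond_mem (Set.toFinite (s : Set (Fin n))).measurableSet
  exact ae_of_ae_map (h.measurable_pick j).eval.aemeasurable hmem

theorem indepFun_arrival_pick_service [IsProbabilityMeasure P]
    (h : IsForkEarlyCancelInput P μ A X pick) : IndepFun
    (fun ω => ((fun j => A j ω : ℕ → ℝ), (fun j => pick j ω : ℕ → Finset (Fin n) → Fin n)))
    (fun ω j i => X j i ω) P := by
  have hA : Measurable fun ω j => A j ω := measurable_pi_iff.2 h.measurable_arrival
  have hpick : Measurable fun ω j => pick j ω := measurable_pi_iff.2 h.measurable_pick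
  have hX : Measurable fun ω j i => X j i ω :=
    measurable_pi_iff.2 fun j => measurable_pi_iff.2 (h.measurable_service j)
  have harrival := h.indep_arrival
  rw [IndepFun_iff_Indep, Prod.instMeasurableSpace, MeasurableSpace.comap_prodMk] at harrival ⊢
  exact indep_sup_left_of_indep_sup_right hA.comap_le hpick.comap_le hX.comap_le
    (sup_comm (MeasurableSpace.comap (fun ω j i => X j i ω) _) _ ▸ harrival)
    h.indep_service_pick.symm

theorem isForkInput [IsProbabilityMeasure P] (h : IsForkEarlyCancelInput P μ A X pick) :
    IsForkInput P μ A X pick where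
  measurable_arrival := h.measurable_arrival
  arrival_nonneg := by
    filter_upwards [h.arrival_nonneg, h.arrival_mono] with ω hzero hmono j
    exact hzero.trans (hmono j.zero_le)
  measurable_pick := h.measurable_pick
  pick_mem := h.ae_pick_mem
  measurable_service := h.measurable_service
  law_service := h.law_service
  indep_service := h.indep_service
  indep_arrival_pick := h.indepFun_arrival_pick_service

end IsForkEarlyCancelInput

end Inputs

section ForkService

variable {Ω : Type*} {n : ℕ} [NeZero n]

/-- The service time of the retained task of job `j` in the random fork-early-cancel system. -/
noncomputable def forkService (A : ℕ → Ω → ℝ) (X : ℕ → Fin n → Ω → ℝ)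
    (pick : ℕ → Ω → Finset (Fin n) → Fin n) (j : ℕ) (ω : Ω) : ℝ :=
  ForkEarlyCancel.retainedService (fun j => A j ω) (fun j i => X j i ω) (fun j => pick j ω) j

theorem forkCost_eq_forkService (A : ℕ → Ω → ℝ) (X : ℕ → Fin n → Ω → ℝ)
    (pick : ℕ → Ω → Finset (Fin n) → Fin n) : forkCost A X pick = forkService A X pick := by
  ext j ω
  exact ForkEarlyCancel.cost_eq_retainedService _ _ _ j

variable [MeasurableSpace Ω] {P : Measure Ω} {μ : Measure ℝ}
  {A : ℕ → Ω → ℝ} {X : ℕ → Fin n → Ω → ℝ} {pick : ℕ → Ω → Finset (Fin n) → Fin n}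

theorem IsForkInput.isQueueInput_forkService (h : IsForkInput P μ A X pick) :
    IsQueueInput P μ A (forkService A X pick) := by
  have := h.indep_service.isProbabilityMeasure
  have hZ := (measurable_pi_iff.2 h.measurable_arrival).prodMk
    (measurable_pi_iff.2 h.measurable_pick)
  set ℱ := rowFiltration hZ h.measurable_service
  let w (j : ℕ) (ω : Ω) : Fin n :=
    ForkEarlyCancel.winner (fun j => A j ω) (fun j i => X j i ω) (fun j => pick j ω) j
  have hw (j : ℕ) : Measurable[ℱ j] (w j) :=
    have hZj := measurable_rowFiltration_left hZ h.measurable_service j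
    @ForkEarlyCancel.measurable_winner _ _ _ (ℱ j) A X pick
      (fun k => ((measurable_pi_apply k).comp measurable_fst).comp hZj)
      (fun k => ((measurable_pi_apply k).comp measurable_snd).comp hZj) j
      fun _ hl i => measurable_rowFiltration_row hZ h.measurable_service hl i
  have hX (j : ℕ) (i : Fin n) : Measurable[ℱ (j + 1)] (X j i) :=
    measurable_rowFiltration_row hZ h.measurable_service j.lt_succ_self i
  have hindep := indep_rowFiltration_row hZ h.measurable_service h.indep_service
    h.indep_arrival_pick
  have hZS : IndepFun (fun ω => ((fun j => A j ω), (fun j => pick j ω)))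
      (fun ω j => forkService A X pick j ω) P :=
    indep_of_indep_of_le_left
      (indep_comap_predictable_select (X := X) (w := w) hX h.law_service hindep hw)
      (measurable_rowFiltration_left hZ h.measurable_service 0).comap_le
  exact {
    measurable_arrival := h.measurable_arrival
    measurable_service := fun j =>
      measurable_select (X := X j) (h.measurable_service j) ((hw j).mono (ℱ.le j) le_rfl)
    law_service := fun j =>
      map_select_of_indep (X := X j) (ℱ.le j) (hw j) (h.measurable_service j) (h.law_service j)
        (hindep j)
    indep_service := iIndepFun_predictable_select (X := X) (w := w) hX h.law_service hindep hw
    indep_arrival := hZS.comp measurable_fst measurable_id }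

theorem IsForkInput.forkHistory_ae_eq (h : IsForkInput P μ A X pick) (hμ : ∀ᵐ x ∂μ, 0 ≤ x) :
    forkHistory A X pick =ᵐ[P] queueHistory n A (forkService A X pick) := by
  have hservice : ∀ᵐ ω ∂P, ∀ j, 0 ≤ forkService A X pick j ω := ae_all_iff.2 fun j =>
    ae_of_ae_map (h.isQueueInput_forkService.measurable_service j).aemeasurable
      ((h.isQueueInput_forkService.law_service j).symm ▸ hμ)
  filter_upwards [h.arrival_nonneg, hservice, h.pick_mem] with ω hA hS hpick
  ext1 j
  have hstart := ForkEarlyCancel.start_eq_queue_start hA hS hpick j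
  simp only [forkHistory, queueHistory, ForkEarlyCancel.departure_eq_start_add, hstart]
  rfl

end ForkService

theorem sum_range_succ_interarrival {Ω : Type*} (A : ℕ → Ω → ℝ) (j : ℕ) (ω : Ω) :
    ∑ l ∈ Finset.range (j + 1), interarrival A l ω = A j ω := by
  induction j with
  | zero => simp [interarrival]
  | succ j ih =>
    rw [Finset.sum_range_succ, ih]
    simp [interarrival]

section IdentDistrib

variable {Ω Ω' : Type*} [MeasurableSpace Ω] [MeasurableSpace Ω'] {P : Measure Ω} {P' : Measure Ω'}

theorem IsQueueInput.identDistrib_queueHistory {n : ℕ} [NeZero n] {μ : Measure ℝ}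
    {A S : ℕ → Ω → ℝ} {A' S' : ℕ → Ω' → ℝ} (h : IsQueueInput P μ A S)
    (h' : IsQueueInput P' μ A' S')
    (hA : IdentDistrib (fun ω j => A j ω) (fun ω j => A' j ω) P P') :
    IdentDistrib (queueHistory n A S) (queueHistory n A' S') P P' := by
  have := h.indep_service.isProbabilityMeasure
  have := h'.indep_service.isProbabilityMeasure
  have hS (j : ℕ) : IdentDistrib (S j) (S' j) P P' :=
    ⟨(h.measurable_service j).aemeasurable, (h'.measurable_service j).aemeasurable,
      (h.law_service j).trans (h'.law_service j).symm⟩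
  have hAS := hA.prodMk (IdentDistrib.pi hS h.indep_service h'.indep_service)
    h.indep_arrival h'.indep_arrival
  exact hAS.comp (measurable_queueHistory (n := n) (A := fun j z => z.1 j) (S := fun j z => z.2 j)
    (by fun_prop) (by fun_prop))

theorem IsForkInput.identDistrib_forkHistory {n : ℕ} [NeZero n] {μ : Measure ℝ}
    {A : ℕ → Ω → ℝ} {X : ℕ → Fin n → Ω → ℝ} {pick : ℕ → Ω → Finset (Fin n) → Fin n}
    {A' S' : ℕ → Ω' → ℝ} (h : IsForkInput P μ A X pick) (hμ : ∀ᵐ x ∂μ, 0 ≤ x)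
    (h' : IsQueueInput P' μ A' S')
    (hA : IdentDistrib (fun ω j => A j ω) (fun ω j => A' j ω) P P') :
    IdentDistrib (forkHistory A X pick) (queueHistory n A' S') P P' :=
  have hqueue := h.isQueueInput_forkService.identDistrib_queueHistory h' hA
  (IdentDistrib.of_ae_eq hqueue.aemeasurable_fst (h.forkHistory_ae_eq hμ).symm).symm.trans hqueue

theorem measurable_interarrival {A : ℕ → Ω → ℝ} (hA : ∀ j, Measurable (A j)) :
    ∀ j, Measurable (interarrival A j)
  | 0 => hA 0
  | j + 1 => (hA (j + 1)).sub (hA j)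

theorem IsPoissonArrivals.identDistrib {lam : ℝ} {A : ℕ → Ω → ℝ} {A' : ℕ → Ω' → ℝ}
    (h : IsPoissonArrivals P lam A) (h' : IsPoissonArrivals P' lam A') :
    IdentDistrib (fun ω j => A j ω) (fun ω j => A' j ω) P P' := by
  have := h.indep.isProbabilityMeasure
  have := h'.indep.isProbabilityMeasure
  have hgap (j : ℕ) : IdentDistrib (interarrival A j) (interarrival A' j) P P' :=
    ⟨(measurable_interarrival h.measurable j).aemeasurable,
      (measurable_interarrival h'.measurable j).aemeasurable, (h.law j).trans (h'.law j).symm⟩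
  have hsum : Measurable fun (x : ℕ → ℝ) (j : ℕ) => ∑ l ∈ Finset.range (j + 1), x l := by fun_prop
  simpa only [Function.comp_def, sum_range_succ_interarrival] using
    (IdentDistrib.pi hgap h.indep h'.indep).comp hsum

theorem mean_eq_of_identDistrib {Y : Ω → ℝ} {Y' : Ω' → ℝ} (h : IdentDistrib Y Y' P P') :
    mean P Y = mean P' Y' :=
  (h.comp ENNReal.measurable_ofReal).lintegral_eq

theorem longRunMean_eq_of_identDistrib {Y : ℕ → Ω → ℝ} {Y' : ℕ → Ω' → ℝ}
    (h : ∀ j, IdentDistrib (Y j) (Y' j) P P') : longRunMean P Y = longRunMean P' Y' := by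
  simp only [longRunMean, fun j => mean_eq_of_identDistrib (h j)]

theorem isSteadyStateLaw_iff_of_identDistrib {Y : ℕ → Ω → ℝ} {Y' : ℕ → Ω' → ℝ}
    (h : ∀ j, IdentDistrib (Y j) (Y' j) P P') (ν : Measure ℝ) :
    IsSteadyStateLaw P Y ν ↔ IsSteadyStateLaw P' Y' ν := by
  have hint (f : ℝ →ᵇ ℝ) (j : ℕ) : ∫ ω, f (Y j ω) ∂P = ∫ ω, f (Y' j ω) ∂P' :=
    ((h j).comp f.continuous.measurable).integral_eq
  simp only [IsSteadyStateLaw, hint]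

end IdentDistrib

theorem longRunMean_of_mean_eq {Ω : Type*} [MeasurableSpace Ω] {P : Measure Ω} {Y : ℕ → Ω → ℝ}
    {m : ℝ≥0∞} (h : ∀ j, mean P (Y j) = m) : longRunMean P Y = m := by
  have haverage : (fun N : ℕ => (∑ j ∈ Finset.range N, mean P (Y j)) / (N : ℝ≥0∞)) =ᶠ[atTop]
      fun _ => m := by
    filter_upwards [eventually_ne_atTop 0] with N hN
    simp only [h, Finset.sum_const, Finset.card_range, nsmul_eq_mul]
    rw [mul_comm, ENNReal.mul_div_cancel_right (Nat.cast_ne_zero.2 hN) (ENNReal.natCast_ne_top N)]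
  rw [longRunMean, limsup_congr haverage, limsup_const]

theorem mainTheorem4_general {Ω Ω' : Type*} [MeasurableSpace Ω] [MeasurableSpace Ω']
    {P : Measure Ω} {P' : Measure Ω'} {n : ℕ} [NeZero n] {μ : Measure ℝ} (hμ : ∀ᵐ x ∂μ, 0 ≤ x)
    {A : ℕ → Ω → ℝ} {X : ℕ → Fin n → Ω → ℝ} {pick : ℕ → Ω → Finset (Fin n) → Fin n}
    (hF : IsForkInput P μ A X pick) :
    (∀ j, mean P (forkCost A X pick j) = mean μ fun x => x) ∧
    longRunMean P (forkCost A X pick) = (mean μ fun x => x) ∧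
    (∀ A' S' : ℕ → Ω' → ℝ, IsQueueInput P' μ A' S' →
      IdentDistrib (fun ω j => A j ω) (fun ω j => A' j ω) P P' →
        IdentDistrib (forkHistory A X pick) (queueHistory n A' S') P P' ∧
        (∀ j, mean P (forkLatency A X pick j) = mean P' (queueResponse n A' S' j)) ∧
        longRunMean P (forkLatency A X pick) = longRunMean P' (queueResponse n A' S') ∧
        ∀ ν : Measure ℝ, IsSteadyStateLaw P (forkLatency A X pick) ν ↔
          IsSteadyStateLaw P' (queueResponse n A' S') ν) := by
  have hcost (j : ℕ) : mean P (forkCost A X pick j) = mean μ fun x => x := by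
    have hS := hF.isQueueInput_forkService
    rw [forkCost_eq_forkService, mean, mean, ← hS.law_service j,
      lintegral_map ENNReal.measurable_ofReal (hS.measurable_service j)]
  refine ⟨hcost, longRunMean_of_mean_eq hcost, fun A' S' hQ hA => ?_⟩
  have hhistory := hF.identDistrib_forkHistory hμ hQ hA
  have hlatency (j : ℕ) : IdentDistrib (forkLatency A X pick j) (queueResponse n A' S' j) P P' :=
    hhistory.comp (u := fun z : ℕ → ℝ × ℝ × ℝ => (z j).2.2 - (z j).1) (by fun_prop)
  exact ⟨hhistory, fun j => mean_eq_of_identDistrib (hlatency j),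
    longRunMean_eq_of_identDistrib hlatency, isSteadyStateLaw_iff_of_identDistrib hlatency⟩

theorem mainTheorem4 {Ω Ω' : Type*} [MeasurableSpace Ω] [MeasurableSpace Ω']
    (P : Measure Ω) [IsProbabilityMeasure P] (P' : Measure Ω') [IsProbabilityMeasure P']
    (n : ℕ) [NeZero n] (μ : Measure ℝ) [IsProbabilityMeasure μ] (hμ : ∀ᵐ x ∂μ, 0 < x)
    (A : ℕ → Ω → ℝ) (X : ℕ → Fin n → Ω → ℝ) (pick : ℕ → Ω → Finset (Fin n) → Fin n)
    (hF : IsForkEarlyCancelInput P μ A X pick) :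
    -- the cost, for any arrival process
    (∀ j, mean P (forkCost A X pick j) = mean μ fun x => x) ∧
    longRunMean P (forkCost A X pick) = (mean μ fun x => x) ∧
    -- the equivalence with the `M/G/n` queue and the latency, for Poisson arrivals
    (∀ lam : ℝ, 0 < lam → IsPoissonArrivals P lam A →
      ∀ A' S' : ℕ → Ω' → ℝ, IsMGInput P' lam μ A' S' →
        IdentDistrib (forkHistory A X pick) (queueHistory n A' S') P P' ∧
        (∀ j, mean P (forkLatency A X pick j) = mean P' (queueResponse n A' S' j)) ∧
        longRunMean P (forkLatency A X pick) = longRunMean P' (queueResponse n A' S') ∧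
        ∀ ν : Measure ℝ, IsSteadyStateLaw P (forkLatency A X pick) ν ↔
          IsSteadyStateLaw P' (queueResponse n A' S') ν) := by
  have hgeneral := mainTheorem4_general (P' := P') (hμ.mono fun _ hx => hx.le) hF.isForkInput
  exact ⟨hgeneral.1, hgeneral.2.1, fun _ _ hA A' S' hQ =>
    hgeneral.2.2 A' S' hQ.isQueueInput (hA.identDistrib hQ.poisson)⟩
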